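/- Let $K$ be a commutative ring with at least $3$ regular elements (non-zero-divisors). The Cremona group $C(K^n)$ is the group of all bijections $\sigma$ of $K^n$ such that $\sigma$ and $\sigma^{-1}$ are given by polynomials; the degree of such a $\sigma$ is the least $d$ such that $\sigma$ is given by polynomials of total degree at most $d$. Subgroups $Q_n\le C(K^n)$ form a family of degree $c$ if for all large $n$ the maximal degree of the elements of $Q_n$ is $c$. Their projective limit is well defined if deleting the last coordinate induces surjective homomorphisms $Q_{n+1}\to Q_n$; it is then the group of compatible sequences $(\sigma_n)$, $\sigma_n\in Q_n$, and $g_n\to g$ means that for each $m$ and all large $n$ the image of $g_n$ in $C(K^m)$ is the component of $g$ in $Q_m$. The orders of $g_n$ grow with $n$ if they tend to infinity (an infinite order counting as $\infty$). A sequence $g_n$ consists of stable elements of degree $c$ if the orders of the $g_n$ grow with $n$ and, for all large $n$, every nonidentical power $g_n^k$ has degree $c$. (1) There is a family of subgroups $Q_n$ of $C(K^n)$ of degree $3$ whose projective limit $Q$ is well defined and infinite and contains an element $g$ of infinite order that is the limit of a sequence $g_n\in Q_n$ of stable elements of degree $3$. (2) Let $D(m,K)$ be the bipartite graph whose points $(p_1,p_{11},p_{12},p_{21},p_{22},p'_{22},p_{23},p_{32},p_{33},p'_{33},\dots)$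 and lines $[l_1,l_{11},l_{12},l_{21},l_{22},l'_{22},\dots]$ have $m$ coordinates in $K$, incidence being given by the first $m-1$ of the relations $l_{11}-p_{11}=l_1p_1$, $l_{12}-p_{12}=l_{11}p_1$, $l_{21}-p_{21}=l_1p_{11}$ and, for $i\ge2$, $l_{ii}-p_{ii}=l_1p_{i-1,i}$, $l'_{ii}-p'_{ii}=l_{i,i-1}p_1$, $l_{i,i+1}-p_{i,i+1}=l_{ii}p_1$, $l_{i+1,i}-p_{i+1,i}=l_1p'_{ii}$. For $n\ge2$ identify the flags (incident pairs of a point and a line) of $D(n-1,K)$ with $K^n$ through the coordinates $(l_1,p_1,p_{11},p_{12},\dots)$. Let $Z(\alpha,\beta)$ be the bijection of the flags that first moves the point along its line so that $p_1$ increases by $\alpha$, and then moves the line around the new point so that $l_1$ increases by $\beta$; let $Q(n,K)$ be the group generated by all $Z(\alpha,\beta)$ with $\alpha,\beta$ regular. (For $n=0$ this is the trivial group, and for $n=1$ only $l_1\mapsto l_1+\beta$ is retained.) Then $Q(n,K)$ is a subgroup of $C(K^n)$ whose maximal degree is $3$ for every $n\ge6$; the projective limit of the $Q(n,K)$ is well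 defined and infinite, and it contains an element $g$ of infinite order that is the limit of a sequence $g_n\in Q(n,K)$ whose orders grow with $n$ and which is stable in the following sense: the cyclic groups $\langle g_n\rangle$ have maximal degree $3$ for all $n\ge6$; for every $k\ge1$ the power $g_n^k$ has degree exactly $3$ for all $n\ge4k+2$; and if $K$ has characteristic zero, then every nonidentical power $g_n^k$, $k\ge 0$, has degree $3$ for all $n\ge6$. -/

import Mathlib

/-! Polynomial bijections of the free module `K^n`, their degrees, families of groups of such
bijections with their projective limits, and the groups of walks on the flags of the graphs
`D(n, K)`. -/

namespace StableCremona

section Cremona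

variable {K : Type*} [CommRing K]

/-- `f` is given by polynomials of total degree at most `d`. -/
def HasDegreeLE {n : ℕ} (f : (Fin n → K) → (Fin n → K)) (d : ℕ) : Prop :=
  ∃ F : Fin n → MvPolynomial (Fin n) K,
    (∀ i, (F i).totalDegree ≤ d) ∧ ∀ x i, f x i = MvPolynomial.eval x (F i)

/-- `f` is a polynomial map `K^n → K^n`. -/
def IsPolynomialMap {n : ℕ} (f : (Fin n → K) → (Fin n → K)) : Prop :=
  ∃ d, HasDegreeLE f d

/-- The degree of a polynomial map of `K^n`: the least `d` such that the map is given by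
polynomials of total degree at most `d`. -/
noncomputable def degree {n : ℕ} (f : (Fin n → K) → (Fin n → K)) : ℕ :=
  sInf {d | HasDegreeLE f d}

theorem IsPolynomialMap.comp {n : ℕ} {f g : (Fin n → K) → (Fin n → K)}
    (hf : IsPolynomialMap f) (hg : IsPolynomialMap g) :
    IsPolynomialMap (fun x => f (g x)) := by
  obtain ⟨d, F, -, hF⟩ := hf
  obtain ⟨e, G, -, hG⟩ := hg
  refine ⟨Finset.univ.sup fun i => (MvPolynomial.bind₁ G (F i)).totalDegree,
    fun i => MvPolynomial.bind₁ G (F i), fun i => ?_, fun x i => ?_⟩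
  · exact Finset.le_sup (f := fun i => (MvPolynomial.bind₁ G (F i)).totalDegree)
      (Finset.mem_univ i)
  · have hx : g x = fun j => MvPolynomial.eval x (G j) := funext fun j => hG x j
    change f (g x) i = _
    rw [hF, hx]
    exact (MvPolynomial.eval₂Hom_bind₁ (RingHom.id K) x G (F i)).symm

theorem isPolynomialMap_id (n : ℕ) :
    IsPolynomialMap (fun x : Fin n → K => x) :=
  ⟨Finset.univ.sup fun i => (MvPolynomial.X i : MvPolynomial (Fin n) K).totalDegree,
    fun i => MvPolynomial.X i,
    fun i => Finset.le_sup
      (f := fun i => (MvPolynomial.X i : MvPolynomial (Fin n) K).totalDegree)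
      (Finset.mem_univ i),
    fun x i => by simp⟩

variable (K) in
/-- The Cremona group `C(K^n)`: the bijections of `K^n` which are polynomial maps together with
their inverses. -/
def Cremona (n : ℕ) : Subgroup (Equiv.Perm (Fin n → K)) where
  carrier := {σ | IsPolynomialMap (fun x => σ x) ∧ IsPolynomialMap (fun x => σ⁻¹ x)}
  one_mem' := ⟨isPolynomialMap_id n, by simpa using isPolynomialMap_id n⟩
  mul_mem' := by
    rintro σ τ ⟨h1, h2⟩ ⟨h3, h4⟩
    exact ⟨h1.comp h3, by rw [mul_inv_rev]; exact h4.comp h2⟩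
  inv_mem' := by
    rintro σ ⟨h1, h2⟩
    exact ⟨h2, by rw [inv_inv]; exact h1⟩

/-- The maximal degree of the elements of `G` is `c`. -/
def HasMaxDegree {n : ℕ} (G : Subgroup (Equiv.Perm (Fin n → K))) (c : ℕ) : Prop :=
  IsGreatest {d | ∃ σ ∈ G, degree (fun x => σ x) = d} c

/-- The groups `Q n` form a family of groups of degree `c` (for all large `n`). -/
def IsFamilyOfDegree (Q : ∀ n : ℕ, Subgroup (Equiv.Perm (Fin n → K))) (c : ℕ) : Prop :=
  ∃ n₀, ∀ n ≥ n₀, HasMaxDegree (Q n) c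

/-- Deleting the last coordinate, `K^(n+1) → K^n`, induces surjective group homomorphisms
`Q (n+1) → Q n`. -/
def IsProjectiveSystem (Q : ∀ n : ℕ, Subgroup (Equiv.Perm (Fin n → K))) : Prop :=
  ∀ n : ℕ, ∃ ω : Q (n + 1) →* Q n, Function.Surjective ω ∧
    ∀ (σ : Q (n + 1)) (x : Fin (n + 1) → K) (i : Fin n),
      (σ : Equiv.Perm (Fin (n + 1) → K)) x i.castSucc =
        (ω σ : Equiv.Perm (Fin n → K)) (fun j => x j.castSucc) i

/-- The projective limit of the groups `Q n` with respect to deleting the last coordinate: the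
group of all sequences `s n ∈ Q n` such that each `s (n+1)` induces `s n`. -/
def projectiveLimit (Q : ∀ n : ℕ, Subgroup (Equiv.Perm (Fin n → K))) :
    Subgroup (∀ n : ℕ, Equiv.Perm (Fin n → K)) where
  carrier := {s | (∀ n, s n ∈ Q n) ∧ ∀ (n : ℕ) (x : Fin (n + 1) → K) (i : Fin n),
    s (n + 1) x i.castSucc = s n (fun j => x j.castSucc) i}
  one_mem' := ⟨fun n => (Q n).one_mem, fun _ _ _ => rfl⟩
  mul_mem' := by
    rintro s t ⟨h1, h2⟩ ⟨h3, h4⟩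
    refine ⟨fun n => (Q n).mul_mem (h1 n) (h3 n), fun n x i => ?_⟩
    simp only [Pi.mul_apply, Equiv.Perm.mul_apply]
    rw [h2]
    exact congrArg (fun y => s n y i) (funext fun j => h4 n x j)
  inv_mem' := by
    rintro s ⟨h1, h2⟩
    refine ⟨fun n => (Q n).inv_mem (h1 n), fun n x i => ?_⟩
    simp only [Pi.inv_apply]
    have h : (fun j : Fin n => x j.castSucc) =
        s n (fun j => (s (n + 1))⁻¹ x j.castSucc) := by
      funext j
      rw [← h2 n ((s (n + 1))⁻¹ x) j]
      exact congrFun ((s (n + 1)).apply_symm_apply x).symm j.castSucc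
    rw [h]
    exact (congrFun ((s n).symm_apply_apply (fun j => (s (n + 1))⁻¹ x j.castSucc)) i).symm

/-- The sequence `s n` tends to the element `g` of a projective limit: for each `m` and all large
`n`, deleting all but the first `m` coordinates carries `s n` to the component `g m`. -/
def ConvergesTo (s g : ∀ n : ℕ, Equiv.Perm (Fin n → K)) : Prop :=
  ∀ m : ℕ, ∃ N, ∀ (n : ℕ) (hmn : m ≤ n), N ≤ n → ∀ (x : Fin n → K) (i : Fin m),
    s n x (Fin.castLE hmn i) = g m (fun j => x (Fin.castLE hmn j)) i

/-- The orders of the `s n` tend to infinity (`orderOf` is `0` for elements of infinite order). -/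
def OrdersGrow (s : ∀ n : ℕ, Equiv.Perm (Fin n → K)) : Prop :=
  ∀ M : ℕ, ∃ N, ∀ n ≥ N, orderOf (s n) = 0 ∨ M ≤ orderOf (s n)

/-- The `s n` form a sequence of stable elements of degree `c`: their orders grow, and for all
large `n` every nonidentical power of `s n` has degree `c`. -/
def IsStableSequence (s : ∀ n : ℕ, Equiv.Perm (Fin n → K)) (c : ℕ) : Prop :=
  OrdersGrow s ∧ ∃ n₀, ∀ n ≥ n₀, ∀ k : ℕ, s n ^ k ≠ 1 → degree (fun x => (s n ^ k) x) = c

end Cremona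

section Walks

variable {K : Type*} [CommRing K]

/-- The right-hand sides of the incidence relations between a point `p` and a line `l`. Points and
lines are written in natural coordinates `0, 1, 2, …`, which stand for
`1; 11; 12; 21; 22; 22'; 23; 32; 33; 33'; 34; 43; …`:
`11 : l₁ p₁`, `12 : l₁₁ p₁`, `21 : l₁ p₁₁`, and for `i ≥ 2`
`ii : l₁ p_{i-1,i}`, `ii' : l_{i,i-1} p₁`, `i,i+1 : l_{ii} p₁`, `i+1,i : l₁ p'_{ii}`. -/
def relationTerm (p l : ℕ → K) : ℕ → K
  | 0 => 0
  | 1 => l 0 * p 0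
  | 2 => l 1 * p 0
  | 3 => l 0 * p 1
  | j + 4 => if j % 4 = 0 ∨ j % 4 = 3 then l 0 * p (j + 2) else l (j + 2) * p 0

/-- Incidence in the graph `D(n, K)`, whose points and lines are given by their first `n`
coordinates: the first `n - 1` relations `l_j - p_j = relationTerm p l j` hold. -/
def Incident (n : ℕ) (p l : ℕ → K) : Prop :=
  ∀ j, 1 ≤ j → j < n → l j - p j = relationTerm p l j

/-- The line with first coordinate `y` through the point `p`. -/
def lineThrough (p : ℕ → K) (y : K) : ℕ → K
  | 0 => y
  | 1 => p 1 + y * p 0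
  | 2 => p 2 + lineThrough p y 1 * p 0
  | 3 => p 3 + y * p 1
  | j + 4 => p (j + 4) +
      if j % 4 = 0 ∨ j % 4 = 3 then y * p (j + 2) else lineThrough p y (j + 2) * p 0

/-- The point with first coordinate `x` on the line `l`. -/
def pointOn (l : ℕ → K) (x : K) : ℕ → K
  | 0 => x
  | 1 => l 1 - l 0 * x
  | 2 => l 2 - l 1 * x
  | 3 => l 3 - l 0 * pointOn l x 1
  | j + 4 => l (j + 4) -
      if j % 4 = 0 ∨ j % 4 = 3 then l 0 * pointOn l x (j + 2) else l (j + 2) * x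

theorem incident_iff_line (n : ℕ) (p l : ℕ → K) :
    Incident n p l ↔ ∀ j < n, l j = lineThrough p (l 0) j := by
  constructor
  · intro h j
    induction j using Nat.strong_induction_on with
    | _ j ih =>
      intro hj
      match j with
      | 0 => rfl
      | 1 => have := h 1 le_rfl hj
             simp only [relationTerm] at this
             simp only [lineThrough]; linear_combination this
      | 2 => have := h 2 (by omega) hj
             simp only [relationTerm] at this
             have h1 := ih 1 (by omega) (by omega)
             rw [lineThrough, ← h1]; linear_combination this
      | 3 => have := h 3 (by omega) hj
             simp only [relationTerm] at this
             rw [lineThrough]; linear_combination this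
      | j + 4 =>
             have := h (j + 4) (by omega) hj
             simp only [relationTerm] at this
             have h1 := ih (j + 2) (by omega) (by omega)
             rw [lineThrough, ← h1]; linear_combination this
  · intro h j h1 hj
    match j with
    | 0 => omega
    | 1 => have := h 1 hj
           rw [lineThrough] at this
           rw [relationTerm]; linear_combination this
    | 2 => have := h 2 hj
           rw [lineThrough, ← h 1 (by omega)] at this
           rw [relationTerm]; linear_combination this
    | 3 => have := h 3 hj
           rw [lineThrough] at this
           rw [relationTerm]; linear_combination this
    | j + 4 => have := h (j + 4) hj
               rw [lineThrough, ← h (j + 2) (by omega)] at this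
               rw [relationTerm]; linear_combination this

theorem incident_iff_point (n : ℕ) (p l : ℕ → K) :
    Incident n p l ↔ ∀ j < n, p j = pointOn l (p 0) j := by
  constructor
  · intro h j
    induction j using Nat.strong_induction_on with
    | _ j ih =>
      intro hj
      match j with
      | 0 => rfl
      | 1 => have := h 1 le_rfl hj
             simp only [relationTerm] at this
             simp only [pointOn]; linear_combination -this
      | 2 => have := h 2 (by omega) hj
             simp only [relationTerm] at this
             rw [pointOn]; linear_combination -this
      | 3 => have := h 3 (by omega) hj
             simp only [relationTerm] at this
             have h1 := ih 1 (by omega) (by omega)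
             rw [pointOn, ← h1]; linear_combination -this
      | j + 4 =>
             have := h (j + 4) (by omega) hj
             simp only [relationTerm] at this
             have h1 := ih (j + 2) (by omega) (by omega)
             rw [pointOn, ← h1]; linear_combination -this
  · intro h j h1 hj
    match j with
    | 0 => omega
    | 1 => have := h 1 hj
           rw [pointOn] at this
           rw [relationTerm]; linear_combination -this
    | 2 => have := h 2 hj
           rw [pointOn] at this
           rw [relationTerm]; linear_combination -this
    | 3 => have := h 3 hj
           rw [pointOn, ← h 1 (by omega)] at this
           rw [relationTerm]; linear_combination -this
    | j + 4 => have := h (j + 4) hj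
               rw [pointOn, ← h (j + 2) (by omega)] at this
               rw [relationTerm]; linear_combination -this

/-- A flag (incident point and line) is given by the vector `f = (l₁, p₁, p₁₁, p₁₂, p₂₁, …)` of
the first coordinate of its line and all coordinates of its point. This is its point. -/
def flagPoint (f : ℕ → K) : ℕ → K := fun j => f (j + 1)

/-- The line of the flag with coordinate vector `f`. -/
def flagLine (f : ℕ → K) : ℕ → K := lineThrough (flagPoint f) (f 0)

/-- The line of a flag stays fixed, and its point moves to the point of that line whose first
coordinate is larger by `α`. -/
def movePoint (α : K) (f : ℕ → K) : ℕ → K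
  | 0 => f 0
  | j + 1 => pointOn (flagLine f) (f 1 + α) j

/-- The point of a flag stays fixed, and its line moves to the line through that point whose first
coordinate is larger by `β`. -/
def moveLine (β : K) (f : ℕ → K) : ℕ → K
  | 0 => f 0 + β
  | j + 1 => f (j + 1)

/-- In the graph `D(n, K)` the point and the line of a flag are incident. -/
theorem incident_flag (n : ℕ) (f : ℕ → K) : Incident n (flagPoint f) (flagLine f) := by
  rw [incident_iff_line]
  intro j _
  simp [flagLine, lineThrough]

/-- `movePoint` fixes the line and changes the first coordinate of the point by `α`. -/
theorem movePoint_spec (α : K) (f : ℕ → K) :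
    flagLine (movePoint α f) = flagLine f ∧ flagPoint (movePoint α f) 0 = flagPoint f 0 + α := by
  refine ⟨?_, by simp [flagPoint, movePoint, pointOn]⟩
  have h : ∀ n, Incident n (flagPoint (movePoint α f)) (flagLine f) := by
    intro n
    rw [incident_iff_point]
    intro j _
    simp [flagPoint, movePoint, pointOn]
  funext j
  have := (incident_iff_line (j + 1) _ _).1 (h (j + 1)) j (Nat.lt_succ_self j)
  rw [this]
  simp [flagLine, movePoint, lineThrough]

/-- `moveLine` fixes the point and changes the first coordinate of the line by `β`. -/
theorem moveLine_spec (β : K) (f : ℕ → K) :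
    flagPoint (moveLine β f) = flagPoint f ∧ flagLine (moveLine β f) 0 = flagLine f 0 + β := by
  refine ⟨by funext j; simp [flagPoint, moveLine], by simp [flagLine, moveLine, lineThrough]⟩

theorem movePoint_neg (α : K) (f : ℕ → K) : movePoint (-α) (movePoint α f) = f := by
  have h := (movePoint_spec α f).1
  funext j
  match j with
  | 0 => simp [movePoint]
  | j + 1 =>
    have h2 := (incident_iff_point (j + 1) _ _).1 (incident_flag (j + 1) f) j (Nat.lt_succ_self j)
    simp only [flagPoint] at h2
    rw [movePoint, h, h2]
    simp [movePoint, pointOn]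

theorem moveLine_neg (β : K) (f : ℕ → K) : moveLine (-β) (moveLine β f) = f := by
  funext j
  match j with
  | 0 => simp [moveLine]
  | j + 1 => simp [moveLine]

theorem lineThrough_congr {p q : ℕ → K} (y : K) (j : ℕ) (h : ∀ i ≤ j, p i = q i) :
    lineThrough p y j = lineThrough q y j := by
  induction j using Nat.strong_induction_on with
  | _ j ih =>
    match j with
    | 0 => rfl
    | 1 => simp only [lineThrough]; rw [h 0 (by omega), h 1 (by omega)]
    | 2 => simp only [lineThrough]; rw [h 0 (by omega), h 1 (by omega), h 2 (by omega)]
    | 3 => simp only [lineThrough]; rw [h 1 (by omega), h 3 (by omega)]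
    | j + 4 =>
      simp only [lineThrough]
      rw [h 0 (by omega), h (j + 2) (by omega), h (j + 4) le_rfl,
        ih (j + 2) (by omega) fun i hi => h i (by omega)]

theorem pointOn_congr {l m : ℕ → K} (x : K) (j : ℕ) (h : ∀ i ≤ j, l i = m i) :
    pointOn l x j = pointOn m x j := by
  induction j using Nat.strong_induction_on with
  | _ j ih =>
    match j with
    | 0 => rfl
    | 1 => simp only [pointOn]; rw [h 0 (by omega), h 1 (by omega)]
    | 2 => simp only [pointOn]; rw [h 1 (by omega), h 2 (by omega)]
    | 3 => simp only [pointOn]; rw [h 0 (by omega), h 1 (by omega), h 3 (by omega)]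
    | j + 4 =>
      simp only [pointOn]
      rw [h 0 (by omega), h (j + 2) (by omega), h (j + 4) le_rfl,
        ih (j + 2) (by omega) fun i hi => h i (by omega)]

theorem movePoint_congr (α : K) {f g : ℕ → K} (j : ℕ) (h : ∀ i ≤ j, f i = g i) :
    movePoint α f j = movePoint α g j := by
  match j with
  | 0 => exact h 0 le_rfl
  | j + 1 =>
    simp only [movePoint]
    rw [h 1 (by omega)]
    refine pointOn_congr _ j fun i hi => ?_
    simp only [flagLine]
    rw [h 0 (by omega)]
    exact lineThrough_congr _ i fun k hk => h (k + 1) (by omega)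

theorem moveLine_congr (β : K) {f g : ℕ → K} (j : ℕ) (h : ∀ i ≤ j, f i = g i) :
    moveLine β f j = moveLine β g j := by
  match j with
  | 0 => simp only [moveLine]; rw [h 0 le_rfl]
  | j + 1 => exact h (j + 1) le_rfl

/-- A vector of `K^n`, continued by zeros. -/
def extend {n : ℕ} (x : Fin n → K) : ℕ → K := fun i => if h : i < n then x ⟨i, h⟩ else 0

/-- A bijection of `K^n` from a bijection of `K^∞` whose `j`-th coordinate, like that of its
inverse, depends only on the coordinates up to `j`. -/
def truncate (n : ℕ) (m m' : (ℕ → K) → (ℕ → K)) (h1 : ∀ f, m' (m f) = f) (h2 : ∀ f, m (m' f) = f)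
    (hm : ∀ (f g : ℕ → K) (j : ℕ), (∀ i ≤ j, f i = g i) → m f j = m g j)
    (hm' : ∀ (f g : ℕ → K) (j : ℕ), (∀ i ≤ j, f i = g i) → m' f j = m' g j) :
    Equiv.Perm (Fin n → K) where
  toFun x := fun i => m (extend x) i
  invFun x := fun i => m' (extend x) i
  left_inv x := by
    funext i
    have h : m' (extend fun i : Fin n => m (extend x) i) i = m' (m (extend x)) i :=
      hm' _ _ _ fun k hk => by simp [extend, lt_of_le_of_lt hk i.isLt]
    simp only [h, h1]
    simp [extend]
  right_inv x := by
    funext i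
    have h : m (extend fun i : Fin n => m' (extend x) i) i = m (m' (extend x)) i :=
      hm _ _ _ fun k hk => by simp [extend, lt_of_le_of_lt hk i.isLt]
    simp only [h, h2]
    simp [extend]

/-- The operator `Z(α, β)` on the flags of the graph `D(n - 1, K)`, a bijection of `K^n`: first the
point of the flag moves along the line by `α`, then the line moves around the new point by `β`. -/
def walkStep (n : ℕ) (α β : K) : Equiv.Perm (Fin n → K) :=
  truncate n (fun f => moveLine β (movePoint α f)) (fun f => movePoint (-α) (moveLine (-β) f))
    (fun f => by rw [moveLine_neg, movePoint_neg])
    (fun f => by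
      have h1 := movePoint_neg (-α) (moveLine (-β) f)
      have h2 := moveLine_neg (-β) f
      rw [neg_neg] at h1 h2
      rw [h1, h2])
    (fun _ _ j h => moveLine_congr β j fun i hi => movePoint_congr α i fun k hk =>
      h k (hk.trans hi))
    (fun _ _ j h => movePoint_congr (-α) j fun i hi => moveLine_congr (-β) i fun k hk =>
      h k (hk.trans hi))

variable (K) in
/-- The group `Q(n, K)` of bijections of `K^n` generated by the operators `Z(α, β)` with regular
`α` and `β`. -/
def walkGroup (n : ℕ) : Subgroup (Equiv.Perm (Fin n → K)) :=
  Subgroup.closure {σ | ∃ α ∈ nonZeroDivisors K, ∃ β ∈ nonZeroDivisors K, σ = walkStep n α β}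

end Walks

end StableCremona

/-!
A bijection of `K^∞` is called triangular if its `j`-th coordinate, like that of its inverse,
depends only on the coordinates up to `j`. A triangular bijection induces bijections of all `K^n`,
so for every group `H` of triangular bijections the images of `H` on the `K^n` form a projective
system, and each element of `H` is an element of the projective limit, approximated by its own
truncations (`isProjectiveSystem_map`, `truncation_mem_projectiveLimit`,
`convergesTo_truncation`). Both families arise in this way. The upper bound `3` for the degrees
comes from a space of functions which `H` maps to itself by composition (`funStabilizer`). The lower
bounds say that a function is not given by a polynomial of degree at most `2`; as `K` may be finite,
they are statements about functions, and are proved by taking finite differences.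

The first family is the cyclic group generated by `cubicShift`, a unipotent shift of `f₃, f₄, …` fed
by the fixed function `f₀ f₁ f₂`. On the power series with coefficients `f₀ f₁ f₂, f₃, f₄, …` it is
multiplication by `1 + X`, so its `k`-th power contains `f₀ f₁ f₂` with binomial coefficients
`k.choose i`, and on `K^n` it is trivial as soon as those coefficients vanish. The trilinear
monomial makes each nonzero coefficient visible as a third difference over every ring.

For the walk groups, the coordinates `p₁, l₁₁, p₁₂, l₂₂, p₂₃, …` and `l₁, p₁₁, l₂₁, p'₂₂, l₃₂, …` of
a flag form two chains. A move along a line or around a point adds to each member of a chain a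
constant multiple of its predecessor (of `1` for the first member). Hence their span with `1` is
stable. Its members have degree at most `2` in the coordinates of the flag, while the remaining
coordinates are `p_{ii} = l_{ii} - l₁ p_{i-1,i}` and `p_{i+1,i} = l_{i+1,i} - l₁ p'_{ii}` with
`p_{i-1,i}` and `p'_{ii}` in the span and `l₁` changed only by constants. So all degrees are at most
`3` (`hasDegreeLE_of_mem_walkGroup`).

The element `g` is `Z(1, 1)`. On the flags `(x, y, 0, 0, …)` the coefficient of `x² y` in the
coordinate `p_{k+1,k+1}` of `g^k` is `1` or `-1`, and in `p₂₂` it is `k`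
(`exists_upper_coeffs`). If `c x² y` agreed with a polynomial of degree at most `2`, a mixed
difference would give `c t² = c t` for all `t` (`coeff_eq_of_hasDegreeLE_two`). For `c = ±1` every
regular element would then be `1`, and for `c = k ≠ 0` in characteristic zero `t = 2` gives
`2 k = 0`.
-/

namespace StableCremona

variable {K : Type*} [CommRing K]

/-! ### Degrees of polynomial maps -/

theorem HasDegreeLE.mono {n d e : ℕ} {f : (Fin n → K) → (Fin n → K)} (h : HasDegreeLE f d)
    (hde : d ≤ e) : HasDegreeLE f e := by
  obtain ⟨F, hF, hf⟩ := h
  exact ⟨F, fun i => (hF i).trans hde, hf⟩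

theorem degree_le {n d : ℕ} {f : (Fin n → K) → (Fin n → K)} (h : HasDegreeLE f d) :
    degree f ≤ d :=
  Nat.sInf_le h

theorem degree_eq_succ {n d : ℕ} {f : (Fin n → K) → (Fin n → K)} (h : HasDegreeLE f (d + 1))
    (h' : ¬ HasDegreeLE f d) : degree f = d + 1 := by
  refine le_antisymm (degree_le h) ?_
  by_contra hlt
  exact h' ((Nat.sInf_mem (s := {d | HasDegreeLE f d}) ⟨_, h⟩).mono (by
    change degree f ≤ d
    omega))

theorem degree_one_le {n : ℕ} :
    degree (fun x => (1 : Equiv.Perm (Fin n → K)) x) ≤ 1 := by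
  refine degree_le ⟨fun i => MvPolynomial.X i, fun i => ?_, fun x i => by simp⟩
  exact (MvPolynomial.isHomogeneous_X K i).totalDegree_le

theorem hasMaxDegree_of_mem {n d : ℕ} {G : Subgroup (Equiv.Perm (Fin n → K))}
    (hG : ∀ σ ∈ G, HasDegreeLE (fun x => σ x) d) {σ : Equiv.Perm (Fin n → K)} (hσ : σ ∈ G)
    (h : degree (fun x => σ x) = d) : HasMaxDegree G d :=
  ⟨⟨σ, hσ, h⟩, by rintro _ ⟨τ, hτ, rfl⟩; exact degree_le (hG τ hτ)⟩

theorem le_cremona {n d : ℕ} {G : Subgroup (Equiv.Perm (Fin n → K))}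
    (hG : ∀ σ ∈ G, HasDegreeLE (fun x => σ x) d) : G ≤ Cremona K n :=
  fun σ hσ => ⟨⟨d, hG σ hσ⟩, ⟨d, hG _ (G.inv_mem hσ)⟩⟩

/-- The vector `(x₀, x₁, x₂, 0, 0, …)`. -/
def threeVec (x y z : K) : ℕ → K
  | 0 => x
  | 1 => y
  | 2 => z
  | _ + 3 => 0

/-- Third differences of quadratic polynomials vanish. -/
theorem third_difference_eq_zero {m : ℕ} (hm : 3 ≤ m) (F : MvPolynomial (Fin m) K)
    (hF : F.totalDegree ≤ 2) {φ : K → K → K → K}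
    (hφ : ∀ x y z, φ x y z = MvPolynomial.eval (fun i : Fin m => threeVec x y z i) F) :
    φ 1 1 1 - φ 1 1 0 - φ 1 0 1 - φ 0 1 1 + φ 1 0 0 + φ 0 1 0 + φ 0 0 1 - φ 0 0 0 = 0 := by
  obtain ⟨n, rfl⟩ : ∃ n, m = n + 3 := ⟨m - 3, by omega⟩
  simp only [hφ, MvPolynomial.eval_eq', ← Finset.sum_sub_distrib, ← Finset.sum_add_distrib]
  refine Finset.sum_eq_zero fun d hd => ?_
  have hd' := (MvPolynomial.le_totalDegree hd).trans hF
  rw [Finsupp.sum_fintype _ _ (fun _ => rfl)] at hd'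
  simp only [Fin.sum_univ_succ] at hd'
  simp only [Fin.prod_univ_succ]
  generalize hD0 : d 0 = d0 at *
  generalize hD1 : d (Fin.succ 0) = d1 at *
  generalize hD2 : d (Fin.succ (Fin.succ 0)) = d2 at *
  have hlt : d0 = 0 ∨ d1 = 0 ∨ d2 = 0 := by omega
  simp only [Fin.val_succ, Fin.val_zero, threeVec]
  rcases hlt with rfl | rfl | rfl <;> simp only [pow_zero, one_pow] <;> ring

/-- The coefficient of `x y` in a quadratic polynomial in `x`, `y` is a mixed difference, and the
mixed difference with step `t` in `x` is `t` times the one with step `1`. -/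
theorem mixed_difference_eq {m : ℕ} (hm : 2 ≤ m) (F : MvPolynomial (Fin m) K)
    (hF : F.totalDegree ≤ 2) {φ : K → K → K}
    (hφ : ∀ x y, φ x y = MvPolynomial.eval (fun i : Fin m => threeVec x y 0 i) F) (t : K) :
    φ t 1 - φ t 0 - φ 0 1 + φ 0 0 = t * (φ 1 1 - φ 1 0 - φ 0 1 + φ 0 0) := by
  obtain ⟨n, rfl⟩ : ∃ n, m = n + 2 := ⟨m - 2, by omega⟩
  simp only [hφ, MvPolynomial.eval_eq', ← Finset.sum_sub_distrib, ← Finset.sum_add_distrib,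
    Finset.mul_sum]
  refine Finset.sum_congr rfl fun d hd => ?_
  have hd' := (MvPolynomial.le_totalDegree hd).trans hF
  rw [Finsupp.sum_fintype _ _ (fun _ => rfl)] at hd'
  simp only [Fin.sum_univ_succ] at hd'
  have h0 : ∀ (x y : K) (i : Fin n), threeVec x y 0 (i.succ.succ : Fin (n + 2)) = 0 := by
    rintro x y ⟨_ | i, hi⟩ <;> rfl
  simp only [Fin.prod_univ_succ, h0]
  generalize hD0 : d 0 = d0 at *
  generalize hD1 : d (Fin.succ 0) = d1 at *
  simp only [Fin.val_succ, Fin.val_zero, threeVec]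
  have hcases : d0 = 0 ∨ d1 = 0 ∨ (d0 = 1 ∧ d1 = 1) := by omega
  rcases hcases with rfl | rfl | ⟨rfl, rfl⟩ <;> simp only [pow_zero, one_pow, pow_one] <;> ring

/-! ### Triangular bijections of `K^∞` and their truncations -/

variable (K) in
/-- The group of the bijections of `K^∞` whose `j`-th coordinate, like that of the inverse, depends
only on the coordinates up to `j`. -/
def Triangular : Subgroup (Equiv.Perm (ℕ → K)) where
  carrier := {σ | (∀ (f g : ℕ → K) (j : ℕ), (∀ i ≤ j, f i = g i) → σ f j = σ g j) ∧
    ∀ (f g : ℕ → K) (j : ℕ), (∀ i ≤ j, f i = g i) → σ⁻¹ f j = σ⁻¹ g j}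
  one_mem' := ⟨fun _ _ j h => h j le_rfl, fun _ _ j h => by simpa using h j le_rfl⟩
  mul_mem' := by
    rintro σ τ ⟨h1, h2⟩ ⟨h3, h4⟩
    refine ⟨fun f g j h => h1 _ _ j fun i hi => h3 _ _ i fun k hk => h k (hk.trans hi),
      fun f g j h => ?_⟩
    rw [mul_inv_rev]
    exact h4 _ _ j fun i hi => h2 _ _ i fun k hk => h k (hk.trans hi)
  inv_mem' := by
    rintro σ ⟨h1, h2⟩
    exact ⟨h2, by rw [inv_inv]; exact h1⟩

instance : CoeFun (Triangular K) fun _ => (ℕ → K) → (ℕ → K) :=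
  ⟨fun σ => (σ : Equiv.Perm (ℕ → K))⟩

/-- A triangular bijection of `K^∞` induces a bijection of `K^n`. -/
def truncation (n : ℕ) : Triangular K →* Equiv.Perm (Fin n → K) where
  toFun σ := truncate n σ (σ⁻¹ : Triangular K) σ.1.symm_apply_apply σ.1.apply_symm_apply σ.2.1 σ.2.2
  map_one' := by
    ext x i
    simp [truncate, extend]
  map_mul' σ τ := by
    ext x i
    refine σ.2.1 _ _ _ fun k hk => ?_
    have hkn : k < n := lt_of_le_of_lt hk i.isLt
    simp [truncate, extend, hkn]

theorem truncation_apply {n : ℕ} (σ : Triangular K) (x : Fin n → K) (i : Fin n) :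
    truncation n σ x i = σ (extend x) i :=
  rfl

/-- Deleting coordinates carries a longer truncation to a shorter one. -/
theorem truncation_castLE (σ : Triangular K) {m n : ℕ} (h : m ≤ n) (x : Fin n → K) (i : Fin m) :
    truncation n σ x (Fin.castLE h i) = truncation m σ (fun j => x (Fin.castLE h j)) i := by
  refine σ.2.1 _ _ _ fun k hk => ?_
  have hkm : k < m := lt_of_le_of_lt hk i.isLt
  simp [extend, hkm, hkm.trans_le h]

theorem isProjectiveSystem_map (H : Subgroup (Triangular K)) :
    IsProjectiveSystem fun n => H.map (truncation n) := by
  intro n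
  have key : ∀ (σ : Triangular K) (x : Fin (n + 1) → K) (i : Fin n),
      truncation (n + 1) σ x i.castSucc = truncation n σ (fun j => x j.castSucc) i :=
    fun σ x i => truncation_castLE σ (Nat.le_succ n) x i
  have hex : ∀ τ : H.map (truncation (n + 1)), ∃ ρ : H.map (truncation n), ∀ (x : Fin (n + 1) → K)
      (i : Fin n), (τ : Equiv.Perm (Fin (n + 1) → K)) x i.castSucc =
          (ρ : Equiv.Perm (Fin n → K)) (fun j => x j.castSucc) i := by
    rintro ⟨_, σ, hσ, rfl⟩
    exact ⟨⟨_, σ, hσ, rfl⟩, key σ⟩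
  -- The induced bijection is unique because every vector of `K^n` has a preimage in `K^(n+1)`.
  have huniq : ∀ ρ ρ' : Equiv.Perm (Fin n → K),
      (∀ (x : Fin (n + 1) → K) (i : Fin n),
        ρ (fun j => x j.castSucc) i = ρ' (fun j => x j.castSucc) i) → ρ = ρ' := by
    intro ρ ρ' h
    ext y i
    simpa using h (Fin.snoc y 0) i
  choose ω hω using hex
  refine ⟨{ toFun := ω, map_one' := ?_, map_mul' := ?_ }, ?_, hω⟩
  · refine Subtype.ext (huniq _ _ fun x i => ?_)
    rw [← hω]
    rfl
  · intro τ τ'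
    refine Subtype.ext (huniq _ _ fun x i => ?_)
    rw [← hω]
    simp only [Subgroup.coe_mul, Equiv.Perm.mul_apply]
    rw [hω]
    exact congrArg (fun y => (ω τ : Equiv.Perm (Fin n → K)) y i) (funext fun j => hω τ' x j)
  · rintro ⟨_, σ, hσ, rfl⟩
    refine ⟨⟨_, σ, hσ, rfl⟩, Subtype.ext (huniq _ _ fun x i => ?_)⟩
    exact (hω ⟨_, σ, hσ, rfl⟩ x i).symm.trans (key σ x i)

theorem truncation_mem_projectiveLimit {H : Subgroup (Triangular K)} {σ : Triangular K}
    (hσ : σ ∈ H) : (fun n => truncation n σ) ∈ projectiveLimit fun n => H.map (truncation n) :=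
  ⟨fun _ => ⟨σ, hσ, rfl⟩, fun n x i => truncation_castLE σ (Nat.le_succ n) x i⟩

theorem convergesTo_truncation (σ : Triangular K) :
    ConvergesTo (fun n => truncation n σ) fun n => truncation n σ :=
  fun _ => ⟨0, fun _ hmn _ x i => truncation_castLE σ hmn x i⟩

theorem ordersGrow_of_pow_ne_one {R : Type*} {s : ∀ n : ℕ, Equiv.Perm (Fin n → R)}
    (h : ∀ k ≥ 1, ∀ n ≥ 4 * k + 2, s n ^ k ≠ 1) : OrdersGrow s := by
  intro M
  refine ⟨4 * M + 2, fun n hn => ?_⟩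
  by_contra! hlt
  exact h (orderOf (s n)) (Nat.one_le_iff_ne_zero.2 hlt.1) n (by omega) (pow_orderOf_eq_one _)

theorem not_isOfFinOrder_of_pow_ne_one {R : Type*} {s : ∀ n : ℕ, Equiv.Perm (Fin n → R)}
    (h : ∀ k ≥ 1, ∀ n ≥ 4 * k + 2, s n ^ k ≠ 1) : ¬ IsOfFinOrder s := by
  rw [isOfFinOrder_iff_pow_eq_one]
  rintro ⟨k, hk, h1⟩
  exact h k hk _ le_rfl (congrFun h1 (4 * k + 2))

theorem infinite_of_not_isOfFinOrder {G : Type*} [Group G] {H : Subgroup G} {g : G} (hg : g ∈ H)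
    (h : ¬ IsOfFinOrder g) : Infinite H := by
  by_contra hfin
  rw [not_infinite_iff_finite] at hfin
  exact h (Submonoid.isOfFinOrder_coe.2 (isOfFinOrder_of_finite (⟨g, hg⟩ : H)))

/-! ### Polynomial functions and spaces of functions stable under triangular bijections -/

variable (K) in
/-- The functions on `K^∞` which on `K^n`, continued by zeros, are given by a polynomial of total
degree at most `d`. -/
def polyFun (n d : ℕ) : Submodule K ((ℕ → K) → K) where
  carrier := {φ | ∃ F : MvPolynomial (Fin n) K, F.totalDegree ≤ d ∧
    ∀ x : Fin n → K, φ (extend x) = MvPolynomial.eval x F}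
  zero_mem' := ⟨0, by simp, by simp⟩
  add_mem' := by
    rintro φ ψ ⟨F, hF, h⟩ ⟨G, hG, h'⟩
    exact ⟨F + G, (MvPolynomial.totalDegree_add F G).trans (max_le hF hG), fun x => by
      simp [h, h']⟩
  smul_mem' := by
    rintro c φ ⟨F, hF, h⟩
    exact ⟨c • F, (MvPolynomial.totalDegree_smul_le c F).trans hF, fun x => by simp [h]⟩

theorem polyFun_mono {n d e : ℕ} (h : d ≤ e) : polyFun K n d ≤ polyFun K n e := by
  rintro φ ⟨F, hF, hφ⟩
  exact ⟨F, hF.trans h, hφ⟩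

theorem mul_mem_polyFun {n d e : ℕ} {φ ψ : (ℕ → K) → K} (hφ : φ ∈ polyFun K n d)
    (hψ : ψ ∈ polyFun K n e) : φ * ψ ∈ polyFun K n (d + e) := by
  obtain ⟨F, hF, h⟩ := hφ
  obtain ⟨G, hG, h'⟩ := hψ
  exact ⟨F * G, (MvPolynomial.totalDegree_mul F G).trans (add_le_add hF hG), fun x => by
    simp [h, h']⟩

theorem one_mem_polyFun (n d : ℕ) : (1 : (ℕ → K) → K) ∈ polyFun K n d :=
  ⟨1, by simp, by simp⟩

theorem coord_mem_polyFun (n j : ℕ) : (fun f => f j) ∈ polyFun K n 1 := by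
  by_cases hj : j < n
  · exact ⟨MvPolynomial.X ⟨j, hj⟩, (MvPolynomial.isHomogeneous_X K _).totalDegree_le,
      fun x => by simp [extend, hj]⟩
  · exact ⟨0, by simp, fun x => by simp [extend, hj]⟩

theorem hasDegreeLE_truncation {n d : ℕ} {σ : Triangular K}
    (h : ∀ j, (fun f => σ f j) ∈ polyFun K n d) :
    HasDegreeLE (fun x => truncation n σ x) d := by
  choose F hF h using h
  exact ⟨fun i => F i, fun i => hF i, fun x i => h i x⟩

/-- The triangular bijections which, like their inverses, map the space `W` of functions to itself
by composition. -/
def funStabilizer (W : Submodule K ((ℕ → K) → K)) : Subgroup (Triangular K) where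
  carrier := {σ | (∀ w ∈ W, w ∘ σ ∈ W) ∧ ∀ w ∈ W, w ∘ (σ⁻¹ : Triangular K) ∈ W}
  one_mem' := ⟨fun _ h => h, fun _ h => by simpa using h⟩
  mul_mem' := by
    rintro σ τ ⟨h1, h2⟩ ⟨h3, h4⟩
    refine ⟨fun w hw => h3 _ (h1 w hw), fun w hw => ?_⟩
    rw [mul_inv_rev]
    exact h2 _ (h4 w hw)
  inv_mem' := by
    rintro σ ⟨h1, h2⟩
    exact ⟨h2, by rw [inv_inv]; exact h1⟩

/-- Stability of a span under composition can be checked on the generators. -/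
theorem comp_mem_span {S : Set ((ℕ → K) → K)} {m : (ℕ → K) → (ℕ → K)}
    (h : ∀ w ∈ S, w ∘ m ∈ Submodule.span K S) :
    ∀ w ∈ Submodule.span K S, w ∘ m ∈ Submodule.span K S := by
  have : Submodule.span K S ≤ (Submodule.span K S).comap (LinearMap.funLeft K K m) :=
    Submodule.span_le.2 h
  exact this

/-! ### A triangular bijection with stable powers over an arbitrary ring -/

/-- The map which fixes `f₀, f₁, f₂`, adds `f₀ f₁ f₂` to `f₃` and adds `f_j` to `f_{j+1}` for
`j ≥ 3`. -/
def cubicShiftFun (f : ℕ → K) : ℕ → K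
  | 0 => f 0
  | 1 => f 1
  | 2 => f 2
  | 3 => f 3 + f 0 * f 1 * f 2
  | j + 4 => f (j + 4) + f (j + 3)

/-- The inverse of `cubicShiftFun`. -/
def cubicShiftInv (f : ℕ → K) : ℕ → K
  | 0 => f 0
  | 1 => f 1
  | 2 => f 2
  | 3 => f 3 - f 0 * f 1 * f 2
  | j + 4 => f (j + 4) - cubicShiftInv f (j + 3)

theorem cubicShiftInv_cubicShiftFun (f : ℕ → K) (j : ℕ) :
    cubicShiftInv (cubicShiftFun f) j = f j := by
  induction j using Nat.strong_induction_on with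
  | _ j ih =>
    match j with
    | 0 | 1 | 2 => rfl
    | 3 => simp [cubicShiftInv, cubicShiftFun]
    | j + 4 =>
      rw [cubicShiftInv, ih (j + 3) (by omega)]
      simp [cubicShiftFun]

theorem cubicShiftFun_cubicShiftInv (f : ℕ → K) (j : ℕ) :
    cubicShiftFun (cubicShiftInv f) j = f j := by
  match j with
  | 0 | 1 | 2 => rfl
  | 3 => simp [cubicShiftInv, cubicShiftFun]
  | j + 4 => simp [cubicShiftFun, cubicShiftInv]

theorem cubicShiftFun_congr {f g : ℕ → K} (j : ℕ) (h : ∀ i ≤ j, f i = g i) :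
    cubicShiftFun f j = cubicShiftFun g j := by
  match j with
  | 0 | 1 | 2 => exact h _ le_rfl
  | 3 =>
    simp only [cubicShiftFun]
    rw [h 0 (by omega), h 1 (by omega), h 2 (by omega), h 3 le_rfl]
  | j + 4 =>
    simp only [cubicShiftFun]
    rw [h (j + 3) (by omega), h (j + 4) le_rfl]

theorem cubicShiftInv_congr {f g : ℕ → K} (j : ℕ) (h : ∀ i ≤ j, f i = g i) :
    cubicShiftInv f j = cubicShiftInv g j := by
  induction j using Nat.strong_induction_on with
  | _ j ih =>
    match j with
    | 0 | 1 | 2 => exact h _ le_rfl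
    | 3 =>
      simp only [cubicShiftInv]
      rw [h 0 (by omega), h 1 (by omega), h 2 (by omega), h 3 le_rfl]
    | j + 4 =>
      simp only [cubicShiftInv]
      rw [h (j + 4) le_rfl, ih (j + 3) (by omega) fun i hi => h i (by omega)]

variable (K) in
/-- The triangular bijection `cubicShiftFun`. -/
def cubicShift : Triangular K :=
  ⟨⟨cubicShiftFun, cubicShiftInv, fun f => funext (cubicShiftInv_cubicShiftFun f),
    fun f => funext (cubicShiftFun_cubicShiftInv f)⟩,
    fun _ _ j h => cubicShiftFun_congr j h, fun _ _ j h => cubicShiftInv_congr j h⟩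

variable (K) in
/-- The coordinate functions and the product of the first three. -/
def cubicFuns : Set ((ℕ → K) → K) :=
  insert (fun f => f 0 * f 1 * f 2) (Set.range fun j f => f j)

theorem coord_mem_span_cubicFuns (j : ℕ) : (fun f => f j) ∈ Submodule.span K (cubicFuns K) :=
  Submodule.subset_span (Or.inr ⟨j, rfl⟩)

theorem span_cubicFuns_le (n : ℕ) : Submodule.span K (cubicFuns K) ≤ polyFun K n 3 := by
  refine Submodule.span_le.2 ?_
  rintro _ (rfl | ⟨j, rfl⟩)
  · exact mul_mem_polyFun (mul_mem_polyFun (coord_mem_polyFun n 0) (coord_mem_polyFun n 1))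
      (coord_mem_polyFun n 2)
  · exact polyFun_mono (by omega) (coord_mem_polyFun n j)

theorem cubicShift_mem_funStabilizer :
    cubicShift K ∈ funStabilizer (Submodule.span K (cubicFuns K)) := by
  have hp : (fun f => f 0 * f 1 * f 2) ∈ Submodule.span K (cubicFuns K) :=
    Submodule.subset_span (Or.inl rfl)
  refine ⟨comp_mem_span ?_, comp_mem_span ?_⟩
  · rintro _ (rfl | ⟨j, rfl⟩)
    · exact hp
    · match j with
      | 0 | 1 | 2 => exact coord_mem_span_cubicFuns _
      | 3 => exact add_mem (coord_mem_span_cubicFuns 3) hp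
      | j + 4 => exact add_mem (coord_mem_span_cubicFuns (j + 4)) (coord_mem_span_cubicFuns (j + 3))
  · rintro _ (rfl | ⟨j, rfl⟩)
    · exact hp
    · change (fun f => cubicShiftInv f j) ∈ _
      induction j using Nat.strong_induction_on with
      | _ j ih =>
        match j with
        | 0 | 1 | 2 => exact coord_mem_span_cubicFuns _
        | 3 => exact sub_mem (coord_mem_span_cubicFuns 3) hp
        | j + 4 => exact sub_mem (coord_mem_span_cubicFuns (j + 4)) (ih (j + 3) (by omega))

theorem hasDegreeLE_of_mem_zpowers_cubicShift {n : ℕ} {τ : Equiv.Perm (Fin n → K)}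
    (hτ : τ ∈ (Subgroup.zpowers (cubicShift K)).map (truncation n)) :
    HasDegreeLE (fun x => τ x) 3 := by
  obtain ⟨σ, hσ, rfl⟩ := hτ
  have h := (Subgroup.zpowers_le.2 (cubicShift_mem_funStabilizer (K := K))) hσ
  exact hasDegreeLE_truncation fun j =>
    span_cubicFuns_le n (h.1 _ (coord_mem_span_cubicFuns j))

/-- The power series with coefficients `f₀ f₁ f₂, f₃, f₄, …`. -/
def cubicSeries (f : ℕ → K) : PowerSeries K :=
  PowerSeries.mk fun
    | 0 => f 0 * f 1 * f 2
    | j + 1 => f (j + 3)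

theorem cubicSeries_cubicShift (f : ℕ → K) :
    cubicSeries (cubicShift K f) = (1 + PowerSeries.X) * cubicSeries f := by
  ext j
  rw [add_mul, one_mul, map_add]
  match j with
  | 0 => simp [cubicSeries, cubicShift, cubicShiftFun]
  | 1 =>
    rw [PowerSeries.coeff_succ_X_mul]
    simp [cubicSeries, cubicShift, cubicShiftFun]
  | j + 2 =>
    rw [PowerSeries.coeff_succ_X_mul]
    simp [cubicSeries, cubicShift, cubicShiftFun]

theorem cubicSeries_cubicShift_pow (k : ℕ) (f : ℕ → K) :
    cubicSeries ((cubicShift K ^ k : Triangular K) f) =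
      (1 + PowerSeries.X) ^ k * cubicSeries f := by
  induction k with
  | zero => simp
  | succ k ih =>
    rw [pow_succ', pow_succ', mul_assoc, ← ih]
    exact cubicSeries_cubicShift _

theorem coeff_one_add_X_pow (k i : ℕ) :
    PowerSeries.coeff i ((1 + PowerSeries.X : PowerSeries K) ^ k) = (k.choose i : K) := by
  have h : (1 + PowerSeries.X : PowerSeries K) ^ k =
      (((1 + Polynomial.X) ^ k : Polynomial K) : PowerSeries K) := by simp
  rw [h, Polynomial.coeff_coe, Polynomial.coeff_one_add_X_pow]

theorem cubicShift_pow_apply_of_lt (k : ℕ) (f : ℕ → K) {j : ℕ} (hj : j < 3) :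
    (cubicShift K ^ k : Triangular K) f j = f j := by
  induction k with
  | zero => simp
  | succ k ih =>
    rw [pow_succ', ← ih]
    interval_cases j <;> rfl

theorem coeff_cubicSeries_succ (j : ℕ) (f : ℕ → K) :
    PowerSeries.coeff (j + 1) (cubicSeries f) = f (j + 3) := by
  simp [cubicSeries]

theorem cubicShift_pow_apply_threeVec (k j : ℕ) (x y z : K) :
    (cubicShift K ^ k : Triangular K) (threeVec x y z) (j + 3) =
      (k.choose (j + 1) : K) * (x * y * z) := by
  have h : cubicSeries (threeVec x y z) = PowerSeries.C (x * y * z) := by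
    ext i
    match i with
    | 0 => simp [cubicSeries, threeVec]
    | i + 1 => simp [coeff_cubicSeries_succ, threeVec]
  rw [← coeff_cubicSeries_succ j ((cubicShift K ^ k : Triangular K) _),
    cubicSeries_cubicShift_pow, h, PowerSeries.coeff_mul_C,
    coeff_one_add_X_pow]

/-- A power of the truncated `cubicShift` is trivial once its binomial coefficients vanish. -/
theorem exists_choose_ne_zero {n k : ℕ} (h : truncation n (cubicShift K ^ k) ≠ 1) :
    ∃ j, j + 3 < n ∧ (k.choose (j + 1) : K) ≠ 0 := by
  by_contra! h0
  refine h (Equiv.ext fun x => funext fun i => ?_)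
  rw [truncation_apply]
  have hx : ((1 : Equiv.Perm (Fin n → K)) x) i = extend x i := by simp [extend]
  rw [hx]
  obtain ⟨i, hi⟩ := i
  by_cases hi3 : i < 3
  · exact cubicShift_pow_apply_of_lt k _ hi3
  · obtain ⟨j, rfl⟩ : ∃ j, i = j + 3 := ⟨i - 3, by omega⟩
    simp only
    rw [← coeff_cubicSeries_succ j ((cubicShift K ^ k : Triangular K) _),
      cubicSeries_cubicShift_pow, ← coeff_cubicSeries_succ j (extend x),
      PowerSeries.coeff_mul, Finset.sum_eq_single (0, j + 1)]
    · simp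
    · rintro ⟨a, b⟩ hab hne
      have hsum : a + b = j + 1 := Finset.HasAntidiagonal.mem_antidiagonal.1 hab
      obtain ⟨a, rfl⟩ : ∃ a', a = a' + 1 := by
        refine ⟨a - 1, ?_⟩
        have : a ≠ 0 := by
          rintro rfl
          exact hne (by rw [← hsum, zero_add])
        omega
      simp only [coeff_one_add_X_pow]
      rw [h0 a (by omega), zero_mul]
    · intro hmem
      simp at hmem

theorem extend_threeVec {n : ℕ} {x y z : K} (h : ∀ i, n ≤ i → threeVec x y z i = 0) :
    extend (fun i : Fin n => threeVec x y z i) = threeVec x y z := by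
  funext i
  by_cases hi : i < n
  · simp [extend, hi]
  · simp [extend, hi, h i (not_lt.1 hi)]

theorem degree_cubicShift_pow {n k j : ℕ} (hj : j + 3 < n) (h : (k.choose (j + 1) : K) ≠ 0) :
    degree (fun x => (truncation n (cubicShift K) ^ k) x) = 3 := by
  rw [← map_pow]
  refine degree_eq_succ (hasDegreeLE_of_mem_zpowers_cubicShift
    ⟨_, Subgroup.npow_mem_zpowers _ k, rfl⟩) ?_
  rintro ⟨F, hF, hev⟩
  have key := third_difference_eq_zero (by omega : 3 ≤ n) (F ⟨j + 3, hj⟩) (hF _)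
    (φ := fun x y z => (k.choose (j + 1) : K) * (x * y * z)) fun x y z => by
      rw [← hev]
      beta_reduce
      rw [truncation_apply, extend_threeVec, cubicShift_pow_apply_threeVec]
      intro i hi
      obtain ⟨i, rfl⟩ : ∃ i', i = i' + 3 := ⟨i - 3, by omega⟩
      rfl
  exact h (by simpa using key)

theorem truncation_cubicShift_pow_ne_one [Nontrivial K] {k n : ℕ} (hk : 1 ≤ k)
    (hn : 4 * k + 2 ≤ n) : truncation n (cubicShift K) ^ k ≠ 1 := by
  intro h
  have h3 := degree_cubicShift_pow (K := K) (n := n) (k := k) (j := k - 1) (by omega)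
    (by simp [Nat.sub_add_cancel hk])
  rw [h] at h3
  have := degree_one_le (K := K) (n := n)
  omega

theorem exists_stable_family [Nontrivial K] :
    ∃ Q : ∀ n : ℕ, Subgroup (Equiv.Perm (Fin n → K)),
      (∀ n, Q n ≤ Cremona K n) ∧
      IsFamilyOfDegree Q 3 ∧
      IsProjectiveSystem Q ∧
      Infinite (projectiveLimit Q) ∧
      ∃ g ∈ projectiveLimit Q, ¬ IsOfFinOrder g ∧
        ∃ s : ∀ n : ℕ, Equiv.Perm (Fin n → K),
          (∀ n, s n ∈ Q n) ∧ ConvergesTo s g ∧ IsStableSequence s 3 := by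
  have hmem : cubicShift K ∈ Subgroup.zpowers (cubicShift K) := Subgroup.mem_zpowers _
  have hpow : ∀ k ≥ 1, ∀ n ≥ 4 * k + 2, truncation n (cubicShift K) ^ k ≠ 1 :=
    fun k hk n hn => truncation_cubicShift_pow_ne_one hk hn
  have hfin := not_isOfFinOrder_of_pow_ne_one hpow
  have hlim := truncation_mem_projectiveLimit hmem
  refine ⟨fun n => (Subgroup.zpowers (cubicShift K)).map (truncation n),
    fun n => le_cremona fun τ => hasDegreeLE_of_mem_zpowers_cubicShift,
    ⟨4, fun n hn => hasMaxDegree_of_mem (fun τ => hasDegreeLE_of_mem_zpowers_cubicShift)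
      ⟨_, hmem, rfl⟩ ?_⟩,
    isProjectiveSystem_map _, infinite_of_not_isOfFinOrder hlim hfin,
    _, hlim, hfin, fun n => truncation n (cubicShift K), fun n => ⟨_, hmem, rfl⟩,
    convergesTo_truncation _, ordersGrow_of_pow_ne_one hpow, 0, fun n _ k hk => ?_⟩
  · simpa using degree_cubicShift_pow (K := K) (n := n) (k := 1) (j := 0) (by omega) (by simp)
  · obtain ⟨j, hj, hne⟩ := exists_choose_ne_zero (K := K) (n := n) (k := k) (by rwa [map_pow])
    exact degree_cubicShift_pow hj hne

/-! ### The coordinate chains of a walk -/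

/-- The point coordinates `p₁, p₁₂, p₂₃, p₃₄, …` of a flag. -/
def upperPoint (f : ℕ → K) : ℕ → K
  | 0 => f 1
  | i + 1 => f (4 * i + 3)

/-- The line coordinates `l₁₁, l₂₂, l₃₃, …` of a flag. -/
def upperLine (f : ℕ → K) : ℕ → K
  | 0 => flagLine f 1
  | i + 1 => flagLine f (4 * i + 4)

/-- The point coordinates `p₁₁, p'₂₂, p'₃₃, …` of a flag. -/
def lowerPoint (f : ℕ → K) (i : ℕ) : K := f (4 * i + 2)

/-- The line coordinates `l₁, l₂₁, l₃₂, l₄₃, …` of a flag. -/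
def lowerLine (f : ℕ → K) : ℕ → K
  | 0 => f 0
  | i + 1 => flagLine f (4 * i + 3)

theorem upperLine_zero (f : ℕ → K) : upperLine f 0 = f 2 + f 0 * f 1 := by
  simp [upperLine, flagLine, flagPoint, lineThrough]

theorem upperLine_succ (f : ℕ → K) (i : ℕ) :
    upperLine f (i + 1) = f (4 * i + 5) + f 0 * f (4 * i + 3) := by
  simp [upperLine, flagLine, flagPoint, lineThrough]

theorem lowerLine_succ (f : ℕ → K) (i : ℕ) :
    lowerLine f (i + 1) = f (4 * i + 4) + f 0 * f (4 * i + 2) := by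
  cases i with
  | zero => simp [lowerLine, flagLine, flagPoint, lineThrough]
  | succ i =>
    have h : 4 * (i + 1) + 3 = (4 * i + 3) + 4 := by ring
    have h' : (4 * i + 3) % 4 = 3 := by omega
    simp only [lowerLine, flagLine, flagPoint, h, lineThrough, h', or_true, if_true]
    congr 1

theorem upperPoint_movePoint_zero (a : K) (f : ℕ → K) :
    upperPoint (movePoint a f) 0 = upperPoint f 0 + a := by
  simp [upperPoint, movePoint, pointOn]

theorem upperPoint_movePoint_succ (a : K) (f : ℕ → K) (i : ℕ) :
    upperPoint (movePoint a f) (i + 1) = upperPoint f (i + 1) - a * upperLine f i := by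
  cases i with
  | zero =>
    simp only [upperPoint, movePoint, pointOn, upperLine]
    simp only [flagLine, flagPoint, lineThrough]
    ring
  | succ i =>
    have hi : ¬((4 * i + 2) % 4 = 0 ∨ (4 * i + 2) % 4 = 3) := by omega
    have hl : flagLine f (4 * i + 2 + 4) =
        f (4 * i + 2 + 4 + 1) + flagLine f (4 * i + 2 + 2) * f 1 := by
      conv_lhs => rw [flagLine, lineThrough, if_neg hi]
      rfl
    change pointOn (flagLine f) (f 1 + a) (4 * i + 2 + 4) =
      f (4 * i + 2 + 4 + 1) - a * flagLine f (4 * i + 2 + 2)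
    rw [pointOn, if_neg hi, hl]
    ring

theorem lowerPoint_movePoint (a : K) (f : ℕ → K) (i : ℕ) :
    lowerPoint (movePoint a f) i = lowerPoint f i - a * lowerLine f i := by
  cases i with
  | zero =>
    simp only [lowerPoint, movePoint, pointOn, lowerLine]
    simp only [flagLine, flagPoint, lineThrough]
    ring
  | succ i =>
    have hi : ¬((4 * i + 1) % 4 = 0 ∨ (4 * i + 1) % 4 = 3) := by omega
    have hl : flagLine f (4 * i + 1 + 4) =
        f (4 * i + 1 + 4 + 1) + flagLine f (4 * i + 1 + 2) * f 1 := by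
      conv_lhs => rw [flagLine, lineThrough, if_neg hi]
      rfl
    change pointOn (flagLine f) (f 1 + a) (4 * i + 1 + 4) =
      f (4 * i + 1 + 4 + 1) - a * flagLine f (4 * i + 1 + 2)
    rw [pointOn, if_neg hi, hl]
    ring

theorem upperLine_movePoint (a : K) (f : ℕ → K) (i : ℕ) :
    upperLine (movePoint a f) i = upperLine f i := by
  cases i <;> simp only [upperLine, (movePoint_spec a f).1]

theorem lowerLine_movePoint (a : K) (f : ℕ → K) (i : ℕ) :
    lowerLine (movePoint a f) i = lowerLine f i := by
  cases i with
  | zero => rfl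
  | succ i => simp only [lowerLine, (movePoint_spec a f).1]

theorem upperPoint_moveLine (b : K) (f : ℕ → K) (i : ℕ) :
    upperPoint (moveLine b f) i = upperPoint f i := by
  cases i <;> rfl

theorem lowerPoint_moveLine (b : K) (f : ℕ → K) (i : ℕ) :
    lowerPoint (moveLine b f) i = lowerPoint f i :=
  rfl

theorem upperLine_moveLine (b : K) (f : ℕ → K) (i : ℕ) :
    upperLine (moveLine b f) i = upperLine f i + b * upperPoint f i := by
  cases i with
  | zero => simp only [upperLine_zero, upperPoint, moveLine]; ring
  | succ i => simp only [upperLine_succ, upperPoint, moveLine]; ring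

theorem lowerLine_moveLine_succ (b : K) (f : ℕ → K) (i : ℕ) :
    lowerLine (moveLine b f) (i + 1) = lowerLine f (i + 1) + b * lowerPoint f i := by
  simp only [lowerLine_succ, lowerPoint, moveLine]; ring

variable (K) in
/-- The constant function `1` and all coordinates of the two chains, as functions of the flag. -/
def chainFuns : Set ((ℕ → K) → K) :=
  {1} ∪ ((Set.range fun i f => upperPoint f i) ∪ (Set.range fun i f => upperLine f i)) ∪
    ((Set.range fun i f => lowerPoint f i) ∪ (Set.range fun i f => lowerLine f i))

theorem one_mem_span_chainFuns : (1 : (ℕ → K) → K) ∈ Submodule.span K (chainFuns K) :=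
  Submodule.subset_span (Or.inl (Or.inl rfl))

theorem upperPoint_mem_span (i : ℕ) :
    (fun f => upperPoint f i) ∈ Submodule.span K (chainFuns K) :=
  Submodule.subset_span (Or.inl (Or.inr (Or.inl ⟨i, rfl⟩)))

theorem upperLine_mem_span (i : ℕ) :
    (fun f => upperLine f i) ∈ Submodule.span K (chainFuns K) :=
  Submodule.subset_span (Or.inl (Or.inr (Or.inr ⟨i, rfl⟩)))

theorem lowerPoint_mem_span (i : ℕ) :
    (fun f => lowerPoint f i) ∈ Submodule.span K (chainFuns K) :=
  Submodule.subset_span (Or.inr (Or.inl ⟨i, rfl⟩))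

theorem lowerLine_mem_span (i : ℕ) :
    (fun f => lowerLine f i) ∈ Submodule.span K (chainFuns K) :=
  Submodule.subset_span (Or.inr (Or.inr ⟨i, rfl⟩))

theorem span_chainFuns_le (n : ℕ) : Submodule.span K (chainFuns K) ≤ polyFun K n 2 := by
  have hc : ∀ j, (fun f => f j) ∈ polyFun K n 2 :=
    fun j => polyFun_mono (by omega) (coord_mem_polyFun n j)
  have hm : ∀ i j, (fun f : ℕ → K => f i * f j) ∈ polyFun K n 2 :=
    fun i j => mul_mem_polyFun (coord_mem_polyFun n i) (coord_mem_polyFun n j)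
  refine Submodule.span_le.2 ?_
  rintro _ ((rfl | (⟨i, rfl⟩ | ⟨i, rfl⟩)) | (⟨i, rfl⟩ | ⟨i, rfl⟩))
  · exact one_mem_polyFun n 2
  · cases i <;> exact hc _
  · cases i with
    | zero => simp only [upperLine_zero]; exact add_mem (hc 2) (hm 0 1)
    | succ i => simp only [upperLine_succ]; exact add_mem (hc _) (hm 0 _)
  · exact hc _
  · cases i with
    | zero => exact hc 0
    | succ i => simp only [lowerLine_succ]; exact add_mem (hc _) (hm 0 _)

theorem comp_movePoint_mem_span (a : K) :
    ∀ w ∈ Submodule.span K (chainFuns K), w ∘ movePoint a ∈ Submodule.span K (chainFuns K) := by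
  refine comp_mem_span ?_
  rintro _ ((rfl | (⟨i, rfl⟩ | ⟨i, rfl⟩)) | (⟨i, rfl⟩ | ⟨i, rfl⟩)) <;> simp only [Function.comp_def]
  · exact one_mem_span_chainFuns
  · cases i with
    | zero =>
      simp only [upperPoint_movePoint_zero]
      refine add_mem (upperPoint_mem_span 0) ?_
      convert Submodule.smul_mem _ a (one_mem_span_chainFuns (K := K)) using 1
      ext; simp
    | succ i =>
      simp only [upperPoint_movePoint_succ]
      exact sub_mem (upperPoint_mem_span _) (Submodule.smul_mem _ a (upperLine_mem_span i))
  · simp only [upperLine_movePoint]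
    exact upperLine_mem_span i
  · simp only [lowerPoint_movePoint]
    exact sub_mem (lowerPoint_mem_span i) (Submodule.smul_mem _ a (lowerLine_mem_span i))
  · simp only [lowerLine_movePoint]
    exact lowerLine_mem_span i

theorem comp_moveLine_mem_span (b : K) :
    ∀ w ∈ Submodule.span K (chainFuns K), w ∘ moveLine b ∈ Submodule.span K (chainFuns K) := by
  refine comp_mem_span ?_
  rintro _ ((rfl | (⟨i, rfl⟩ | ⟨i, rfl⟩)) | (⟨i, rfl⟩ | ⟨i, rfl⟩)) <;> simp only [Function.comp_def]
  · exact one_mem_span_chainFuns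
  · simp only [upperPoint_moveLine]
    exact upperPoint_mem_span i
  · simp only [upperLine_moveLine]
    exact add_mem (upperLine_mem_span i) (Submodule.smul_mem _ b (upperPoint_mem_span i))
  · simp only [lowerPoint_moveLine]
    exact lowerPoint_mem_span i
  · cases i with
    | zero =>
      simp only [lowerLine, moveLine]
      refine add_mem (lowerLine_mem_span 0) ?_
      convert Submodule.smul_mem _ b (one_mem_span_chainFuns (K := K)) using 1
      ext; simp
    | succ i =>
      simp only [lowerLine_moveLine_succ]
      exact add_mem (lowerLine_mem_span _) (Submodule.smul_mem _ b (lowerPoint_mem_span i))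

/-! ### Walk groups have degree at most `3` -/

/-- The operator `Z(α, β)` on the flags of the infinite graph. -/
def infiniteWalkStep (α β : K) : Triangular K :=
  ⟨⟨fun f => moveLine β (movePoint α f), fun f => movePoint (-α) (moveLine (-β) f),
    fun f => by simp only [moveLine_neg, movePoint_neg],
    fun f => by
      have h1 := movePoint_neg (-α) (moveLine (-β) f)
      have h2 := moveLine_neg (-β) f
      rw [neg_neg] at h1 h2
      simp only [h1, h2]⟩,
    fun _ _ j h => moveLine_congr β j fun i hi => movePoint_congr α i fun k hk => h k (hk.trans hi),
    fun _ _ j h => movePoint_congr (-α) j fun i hi => moveLine_congr (-β) i fun k hk =>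
      h k (hk.trans hi)⟩

theorem truncation_infiniteWalkStep (n : ℕ) (α β : K) :
    truncation n (infiniteWalkStep α β) = walkStep n α β :=
  rfl

variable (K) in
/-- The group generated by the operators `Z(α, β)` with regular `α`, `β` on the flags of the
infinite graph. -/
def infiniteWalkGroup : Subgroup (Triangular K) :=
  Subgroup.closure {σ | ∃ α ∈ nonZeroDivisors K, ∃ β ∈ nonZeroDivisors K, σ = infiniteWalkStep α β}

theorem map_infiniteWalkGroup (n : ℕ) :
    (infiniteWalkGroup K).map (truncation n) = walkGroup K n := by
  rw [infiniteWalkGroup, MonoidHom.map_closure, walkGroup]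
  congr 1
  ext τ
  constructor
  · rintro ⟨_, ⟨α, hα, β, hβ, rfl⟩, rfl⟩
    exact ⟨α, hα, β, hβ, rfl⟩
  · rintro ⟨α, hα, β, hβ, rfl⟩
    exact ⟨_, ⟨α, hα, β, hβ, rfl⟩, rfl⟩

theorem infiniteWalkGroup_le_funStabilizer :
    infiniteWalkGroup K ≤ funStabilizer (Submodule.span K (chainFuns K)) := by
  refine (Subgroup.closure_le _).2 ?_
  rintro _ ⟨α, -, β, -, rfl⟩
  exact ⟨fun w hw => comp_movePoint_mem_span α _ (comp_moveLine_mem_span β w hw),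
    fun w hw => comp_moveLine_mem_span (-β) _ (comp_movePoint_mem_span (-α) w hw)⟩

/-- Every element of the walk group changes the first line coordinate by a constant. -/
theorem exists_apply_zero_eq_add {σ : Triangular K} (hσ : σ ∈ infiniteWalkGroup K) :
    ∃ b : K, ∀ f, σ f 0 = f 0 + b := by
  induction hσ using Subgroup.closure_induction with
  | mem σ h =>
    obtain ⟨α, -, β, -, rfl⟩ := h
    exact ⟨β, fun f => rfl⟩
  | one => exact ⟨0, fun f => by simp⟩
  | mul σ τ _ _ h1 h2 =>
    obtain ⟨b, hb⟩ := h1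
    obtain ⟨c, hc⟩ := h2
    refine ⟨c + b, fun f => ?_⟩
    rw [← add_assoc, ← hc, ← hb]
    rfl
  | inv σ _ h =>
    obtain ⟨b, hb⟩ := h
    refine ⟨-b, fun f => ?_⟩
    have h := hb ((σ⁻¹ : Triangular K) f)
    have h' : σ ((σ⁻¹ : Triangular K) f) = f := σ.1.apply_symm_apply f
    rw [h'] at h
    rw [h]
    ring

theorem coord_mem_polyFun_of_mem_infiniteWalkGroup {σ : Triangular K}
    (hσ : σ ∈ infiniteWalkGroup K) (n j : ℕ) : (fun f => σ f j) ∈ polyFun K n 3 := by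
  obtain ⟨b, hb⟩ := exists_apply_zero_eq_add hσ
  have h0 : (fun f => σ f 0) ∈ polyFun K n 1 := by
    simp only [hb]
    refine add_mem (coord_mem_polyFun n 0) ?_
    convert Submodule.smul_mem _ b (one_mem_polyFun (K := K) n 1) using 1
    ext; simp
  have hW : ∀ w ∈ Submodule.span K (chainFuns K), w ∘ σ ∈ polyFun K n 2 := fun w hw =>
    span_chainFuns_le n ((infiniteWalkGroup_le_funStabilizer hσ).1 w hw)
  have h23 := polyFun_mono (K := K) (n := n) (by omega : 2 ≤ 3)
  match j with
  | 0 => exact polyFun_mono (by omega) h0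
  | 1 => exact h23 (hW _ (upperPoint_mem_span 0))
  | j + 2 =>
    -- The coordinates after the second one come in periods of four.
    obtain ⟨i, r, hr, rfl⟩ : ∃ i r, r < 4 ∧ j = 4 * i + r :=
      ⟨j / 4, j % 4, Nat.mod_lt _ (by omega), (Nat.div_add_mod j 4).symm⟩
    interval_cases r
    · exact h23 (hW _ (lowerPoint_mem_span i))
    · exact h23 (hW _ (upperPoint_mem_span (i + 1)))
    · have h : (fun f => σ f (4 * i + 2 + 2)) =
          ((fun f => lowerLine f (i + 1)) ∘ σ) -
            (fun f => σ f 0) * ((fun f => lowerPoint f i) ∘ σ) := by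
        funext f
        simp [lowerLine_succ, lowerPoint]
      rw [h]
      exact sub_mem (h23 (hW _ (lowerLine_mem_span _)))
        (mul_mem_polyFun h0 (hW _ (lowerPoint_mem_span _)))
    · have h : (fun f => σ f (4 * i + 3 + 2)) =
          ((fun f => upperLine f (i + 1)) ∘ σ) -
            (fun f => σ f 0) * ((fun f => upperPoint f (i + 1)) ∘ σ) := by
        funext f
        simp [upperLine_succ, upperPoint]
      rw [h]
      exact sub_mem (h23 (hW _ (upperLine_mem_span _)))
        (mul_mem_polyFun h0 (hW _ (upperPoint_mem_span _)))

theorem hasDegreeLE_of_mem_walkGroup {n : ℕ} {τ : Equiv.Perm (Fin n → K)}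
    (hτ : τ ∈ walkGroup K n) : HasDegreeLE (fun x => τ x) 3 := by
  rw [← map_infiniteWalkGroup] at hτ
  obtain ⟨σ, hσ, rfl⟩ := hτ
  exact hasDegreeLE_truncation fun j => coord_mem_polyFun_of_mem_infiniteWalkGroup hσ n j

/-! ### Powers of `Z(1, 1)` -/

theorem upperPoint_step_zero (f : ℕ → K) :
    upperPoint (infiniteWalkStep 1 1 f) 0 = upperPoint f 0 + 1 := by
  change upperPoint (moveLine 1 (movePoint 1 f)) 0 = _
  rw [upperPoint_moveLine, upperPoint_movePoint_zero]

theorem upperPoint_step_succ (f : ℕ → K) (i : ℕ) :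
    upperPoint (infiniteWalkStep 1 1 f) (i + 1) = upperPoint f (i + 1) - upperLine f i := by
  change upperPoint (moveLine 1 (movePoint 1 f)) (i + 1) = _
  rw [upperPoint_moveLine, upperPoint_movePoint_succ, one_mul]

theorem upperLine_step (f : ℕ → K) (i : ℕ) :
    upperLine (infiniteWalkStep 1 1 f) i =
      upperLine f i + upperPoint (infiniteWalkStep 1 1 f) i := by
  change upperLine (moveLine 1 (movePoint 1 f)) i =
    _ + upperPoint (moveLine 1 (movePoint 1 f)) i
  rw [upperLine_moveLine, upperLine_movePoint, upperPoint_moveLine, one_mul]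

/-- On the flags `(x, y, 0, 0, …)` the upper chain coordinates of `Z(1, 1)^k` are combinations of
`1`, `y` and `x y`. The coefficient `c i` of `x y` in the point coordinate with index `i` is `-k`
for `i = 1` and `(-1)^k` for `i = k`. -/
theorem exists_upper_coeffs (k : ℕ) : ∃ a b c a' b' c' : ℕ → K,
    (∀ x y i, upperPoint ((infiniteWalkStep 1 1 ^ k : Triangular K) (threeVec x y 0)) i =
      a i + b i * y + c i * (x * y)) ∧
    (∀ x y i, upperLine ((infiniteWalkStep 1 1 ^ k : Triangular K) (threeVec x y 0)) i =
      a' i + b' i * y + c' i * (x * y)) ∧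
    c 0 = 0 ∧ c' 0 = 1 ∧ c 1 = -k ∧ (∀ i > k, c i = 0 ∧ c' i = 0) ∧ c' k = (-1) ^ k ∧
    (1 ≤ k → c k = (-1) ^ k) := by
  induction k with
  | zero =>
    refine ⟨0, fun i => if i = 0 then 1 else 0, 0, 0, 0, fun i => if i = 0 then 1 else 0,
      fun x y i => ?_, fun x y i => ?_, rfl, rfl, by simp, fun i hi => ?_, by simp, by simp⟩
    · cases i <;> simp [upperPoint, threeVec]
    · cases i <;> simp [upperLine_zero, upperLine_succ, threeVec]
    · simp; omega
  | succ k ih =>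
    obtain ⟨a, b, c, a', b', c', hP, hL, h0, h0', h1, hbig, hk', -⟩ := ih
    let A : ℕ → K := fun | 0 => a 0 + 1 | i + 1 => a (i + 1) - a' i
    let B : ℕ → K := fun | 0 => b 0 | i + 1 => b (i + 1) - b' i
    let C : ℕ → K := fun | 0 => c 0 | i + 1 => c (i + 1) - c' i
    have hstep : ∀ f : ℕ → K, (infiniteWalkStep 1 1 ^ (k + 1) : Triangular K) f =
        infiniteWalkStep 1 1 ((infiniteWalkStep 1 1 ^ k : Triangular K) f) := fun f => by
      rw [pow_succ']
      rfl
    have hA : ∀ x y i, upperPoint ((infiniteWalkStep 1 1 ^ (k + 1) : Triangular K)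
        (threeVec x y 0)) i = A i + B i * y + C i * (x * y) := by
      intro x y i
      rw [hstep]
      cases i with
      | zero => rw [upperPoint_step_zero, hP]; simp only [A, B, C]; ring
      | succ i => rw [upperPoint_step_succ, hP, hL]; simp only [A, B, C]; ring
    have hC : C (k + 1) = (-1) ^ (k + 1) := by
      simp only [C, (hbig (k + 1) (by omega)).1, hk']; ring
    refine ⟨A, B, C, a' + A, b' + B, c' + C, hA, fun x y i => ?_, h0, ?_, ?_, fun i hi => ?_, ?_,
      fun _ => hC⟩
    · have h := hA x y i
      rw [hstep] at h ⊢
      rw [upperLine_step, h, hL]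
      simp only [Pi.add_apply]
      ring
    · simp [C, h0, h0']
    · simp only [C, zero_add, h1, h0']
      push_cast
      ring
    · obtain ⟨j, rfl⟩ : ∃ j, i = j + 1 := ⟨i - 1, by omega⟩
      have hCj : C (j + 1) = 0 := by
        simp only [C, (hbig (j + 1) (by omega)).1, (hbig j (by omega)).2, sub_zero]
      exact ⟨hCj, by simp [hCj, (hbig (j + 1) (by omega)).2]⟩
    · simp [hC, (hbig (k + 1) (by omega)).2]

theorem infiniteWalkStep_pow_apply_zero (k : ℕ) (f : ℕ → K) :
    (infiniteWalkStep 1 1 ^ k : Triangular K) f 0 = f 0 + k := by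
  induction k with
  | zero => simp
  | succ k ih =>
    rw [pow_succ']
    change (infiniteWalkStep 1 1 ^ k : Triangular K) f 0 + 1 = _
    rw [ih]
    push_cast
    ring

/-- If a power of `Z(1, 1)` has degree at most `2`, then the coefficients `-c m` of `x² y` in the
coordinates `p_{m+1,m+1}` satisfy `c m t² = c m t` for all `t`. -/
theorem coeff_eq_of_hasDegreeLE_two {n k : ℕ}
    (h : HasDegreeLE (fun x => (walkStep n (1 : K) 1 ^ k) x) 2) :
    ∃ c : ℕ → K, c 1 = -k ∧ (1 ≤ k → c k = (-1) ^ k) ∧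
      ∀ m, 1 ≤ m → 4 * m + 1 < n → ∀ t, c m * (t * t) = c m * t := by
  obtain ⟨a, b, c, a', b', c', hP, hL, -, -, h1, -, -, hk⟩ := exists_upper_coeffs (K := K) k
  refine ⟨c, h1, hk, fun m hm hmn t => ?_⟩
  obtain ⟨F, hF, hev⟩ := h
  obtain ⟨i, rfl⟩ : ∃ i, m = i + 1 := ⟨m - 1, by omega⟩
  have key := mixed_difference_eq (by omega : 2 ≤ n) (F ⟨4 * (i + 1) + 1, hmn⟩) (hF _)
    (φ := fun x y => a' (i + 1) + b' (i + 1) * y + c' (i + 1) * (x * y) -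
      (x + k) * (a (i + 1) + b (i + 1) * y + c (i + 1) * (x * y))) (fun x y => by
      rw [← hev]
      beta_reduce
      rw [← truncation_infiniteWalkStep, ← map_pow, truncation_apply, extend_threeVec, ← hP,
        ← hL, upperLine_succ, infiniteWalkStep_pow_apply_zero]
      · simp only [upperPoint, threeVec]
        have : 4 * (i + 1) + 1 = 4 * i + 5 := by ring
        rw [this]
        ring
      · intro j hj
        obtain ⟨j, rfl⟩ : ∃ j', j = j' + 3 := ⟨j - 3, by omega⟩
        rfl) t
  linear_combination -key

theorem walkStep_mem_walkGroup (n : ℕ) : walkStep n (1 : K) 1 ∈ walkGroup K n :=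
  Subgroup.subset_closure ⟨1, one_mem _, 1, one_mem _, rfl⟩

theorem degree_walkStep_pow (hK : 1 < Set.encard (nonZeroDivisors K : Set K)) {k n : ℕ}
    (hk : 1 ≤ k) (hn : 4 * k + 2 ≤ n) : degree (fun x => (walkStep n (1 : K) 1 ^ k) x) = 3 := by
  refine degree_eq_succ (hasDegreeLE_of_mem_walkGroup (pow_mem (walkStep_mem_walkGroup n) k)) ?_
  intro h
  obtain ⟨c, -, hck, hc⟩ := coeff_eq_of_hasDegreeLE_two h
  -- The leading coefficient is a unit, so all `t` are idempotent and `1` is the only regular one.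
  have hidem : ∀ t : K, t * t = t := fun t => by
    have := hc k hk (by omega) t
    rw [hck hk] at this
    exact (isUnit_one.neg.pow k).mul_left_cancel this
  obtain ⟨t, s, ht, hs, hts⟩ := Set.one_lt_encard_iff.1 hK
  have hone : ∀ u ∈ nonZeroDivisors K, u = 1 := fun u hu =>
    (mul_cancel_left_mem_nonZeroDivisors hu).1 (by rw [hidem, mul_one])
  exact hts ((hone t ht).trans (hone s hs).symm)

theorem degree_walkStep_pow_of_charZero [CharZero K] {k n : ℕ} (hk : k ≠ 0) (hn : 6 ≤ n) :
    degree (fun x => (walkStep n (1 : K) 1 ^ k) x) = 3 := by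
  refine degree_eq_succ (hasDegreeLE_of_mem_walkGroup (pow_mem (walkStep_mem_walkGroup n) k)) ?_
  intro h
  obtain ⟨c, h1, -, hc⟩ := coeff_eq_of_hasDegreeLE_two h
  have h2 := hc 1 le_rfl (by omega) 2
  rw [h1] at h2
  have h3 : ((2 * k : ℕ) : K) = 0 := by
    push_cast
    linear_combination -h2
  rw [Nat.cast_eq_zero] at h3
  omega

end StableCremona

open StableCremona in
theorem theorem1 (K : Type*) [CommRing K] (hK : 3 ≤ Set.encard (nonZeroDivisors K : Set K)) :
    -- some family has all the required properties
    (∃ Q : ∀ n : ℕ, Subgroup (Equiv.Perm (Fin n → K)),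
      (∀ n, Q n ≤ Cremona K n) ∧
      IsFamilyOfDegree Q 3 ∧
      IsProjectiveSystem Q ∧
      Infinite (projectiveLimit Q) ∧
      ∃ g ∈ projectiveLimit Q, ¬ IsOfFinOrder g ∧
        ∃ s : ∀ n : ℕ, Equiv.Perm (Fin n → K),
          (∀ n, s n ∈ Q n) ∧ ConvergesTo s g ∧ IsStableSequence s 3) ∧
    -- the explicit family of walk groups
    ((∀ n, walkGroup K n ≤ Cremona K n) ∧
      (∀ n ≥ 6, HasMaxDegree (walkGroup K n) 3) ∧
      IsProjectiveSystem (walkGroup K) ∧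
      Infinite (projectiveLimit (walkGroup K)) ∧
      ∃ g ∈ projectiveLimit (walkGroup K), ¬ IsOfFinOrder g ∧
        ∃ s : ∀ n : ℕ, Equiv.Perm (Fin n → K),
          (∀ n, s n ∈ walkGroup K n) ∧ ConvergesTo s g ∧ OrdersGrow s ∧
          (∀ n ≥ 6, HasMaxDegree (Subgroup.zpowers (s n)) 3) ∧
          (∀ k ≥ 1, ∀ n ≥ 4 * k + 2, degree (fun x => (s n ^ k) x) = 3) ∧
          (CharZero K → ∀ n ≥ 6, ∀ k : ℕ, s n ^ k ≠ 1 →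
            degree (fun x => (s n ^ k) x) = 3)) := by
  have hK1 : 1 < Set.encard (nonZeroDivisors K : Set K) := lt_of_lt_of_le (by norm_num) hK
  have : Nontrivial K := by
    obtain ⟨t, s, -, -, hts⟩ := Set.one_lt_encard_iff.1 hK1
    exact ⟨t, s, hts⟩
  refine ⟨exists_stable_family, ?_⟩
  have hQ : walkGroup K = fun n => (infiniteWalkGroup K).map (truncation n) :=
    funext fun n => (map_infiniteWalkGroup n).symm
  have hdeg : ∀ k ≥ 1, ∀ n ≥ 4 * k + 2, degree (fun x => (walkStep n (1 : K) 1 ^ k) x) = 3 :=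
    fun k hk n hn => degree_walkStep_pow hK1 hk hn
  have hdeg1 : ∀ n ≥ 6, degree (fun x => walkStep n (1 : K) 1 x) = 3 := fun n hn => by
    simpa using hdeg 1 le_rfl n hn
  have hpow : ∀ k ≥ 1, ∀ n ≥ 4 * k + 2, walkStep n (1 : K) 1 ^ k ≠ 1 := by
    intro k hk n hn h
    have h3 := hdeg k hk n hn
    rw [h] at h3
    have := degree_one_le (K := K) (n := n)
    omega
  have hfin := not_isOfFinOrder_of_pow_ne_one hpow
  have hlim : (fun n => walkStep n (1 : K) 1) ∈ projectiveLimit (walkGroup K) := by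
    rw [hQ]
    exact truncation_mem_projectiveLimit (σ := infiniteWalkStep 1 1)
      (Subgroup.subset_closure ⟨1, one_mem _, 1, one_mem _, rfl⟩)
  refine ⟨fun n => le_cremona fun τ hτ => hasDegreeLE_of_mem_walkGroup hτ,
    fun n hn => hasMaxDegree_of_mem (fun τ hτ => hasDegreeLE_of_mem_walkGroup hτ)
      (walkStep_mem_walkGroup n) (hdeg1 n hn),
    by rw [hQ]; exact isProjectiveSystem_map _, infinite_of_not_isOfFinOrder hlim hfin,
    _, hlim, hfin,
    fun n => walkStep n 1 1, walkStep_mem_walkGroup,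
    convergesTo_truncation (infiniteWalkStep 1 1), ordersGrow_of_pow_ne_one hpow,
    fun n hn => hasMaxDegree_of_mem (fun τ hτ => hasDegreeLE_of_mem_walkGroup
      ((Subgroup.zpowers_le.2 (walkStep_mem_walkGroup n)) hτ))
      (Subgroup.mem_zpowers _) (hdeg1 n hn), hdeg, ?_⟩
  intro _ n hn k hk
  exact degree_walkStep_pow_of_charZero (by rintro rfl; exact hk (pow_zero _)) hn
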